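/- All rings are commutative and local rings are Noetherian. Let $(R,\mathfrak m)$ be a local ring of Krull dimension $d$. $R$ is Cohen–Macaulay (CM) if $\operatorname{depth} R=d$; a finitely generated $R$-module $X$ is maximal Cohen–Macaulay if $X=0$ or $\operatorname{depth}_R X=d$. For a finitely generated $R$-module $M$, Auslander's invariant $\delta_R(M)$ is the smallest integer $n\ge 0$ for which there is a surjective $R$-linear map $X\oplus R^n\to M$ with $X$ a maximal Cohen–Macaulay $R$-module that has no nonzero free direct summand. When $R$ is CM, put $\operatorname{index}(R)=\inf\{n\ge 1 : \delta_R(R/\mathfrak m^n)=1\}\in\mathbb N\cup\{\infty\}$. The generalized Loewy length $\operatorname{g\ell\ell}(R)$ is the smallest integer $n\ge 1$ for which $\mathfrak m^n$ is contained in the ideal generated by some system of parameters of $R$. For a prime ideal $\mathfrak p$ of $R$ and $n\ge 0$, let $\mathfrak p^{(n)}=R\cap\mathfrak p^nR_{\mathfrak p}$ (the preimage of $\mathfrak p^nR_{\mathfrak p}$ in $R$) be the $n$-th symbolic power, so $\mathfrak p^{(0)}=R$. **Proposition 2.22.** Let $R$ be a Cohen–Macaulay local ring and let $\mathfrak p$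 be a prime ideal of $R$ of height one such that $s=\operatorname{index}(R_{\mathfrak p})$ is finite. Let $t\ge 1$ be an integer and let $x\in\mathfrak p^{(t)}\setminus\mathfrak p^{(t+1)}$ be a nonzerodivisor of $R$ such that for every $1\le i\le s$ the map $$\overline{x}:\ \mathfrak p^{(i-1)}/\mathfrak p^{(i)}\longrightarrow \mathfrak p^{(i+t-1)}/\mathfrak p^{(i+t)}$$ induced by multiplication by $x$ is injective. Then $$\operatorname{g\ell\ell}(R_{\mathfrak p})\le \operatorname{index}(R_{\mathfrak p})+t-1 .$$ -/

import Mathlib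

universe u v

namespace CMLocal

open IsLocalRing

/-- The depth of a module `M` over a local ring `R`: the supremum of the lengths of the
`M`-regular sequences contained in the maximal ideal. -/
noncomputable def depth (R : Type u) [CommRing R] [IsLocalRing R]
    (M : Type v) [AddCommGroup M] [Module R M] : ℕ∞ :=
  ⨆ (rs : List R) (_ : (∀ r ∈ rs, r ∈ maximalIdeal R) ∧ RingTheory.Sequence.IsRegular M rs),
    (rs.length : ℕ∞)

/-- A Cohen-Macaulay local ring: a Noetherian local ring whose depth equals its Krull dimension. -/
structure IsCohenMacaulayLocalRing (R : Type u) [CommRing R] [IsLocalRing R] : Prop where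
  isNoetherianRing : IsNoetherianRing R
  depth_eq_dim : (depth R R : WithBot ℕ∞) = ringKrullDim R

/-- Maximal Cohen-Macaulay modules over a local ring: finitely generated modules `M` with
`depth M = dim R`. As usual the zero module (whose depth is `∞` by convention) is admitted. -/
structure IsMaximalCohenMacaulay (R : Type u) [CommRing R] [IsLocalRing R]
    (M : Type v) [AddCommGroup M] [Module R M] : Prop where
  finite : Module.Finite R M
  depth_eq_dim : Nontrivial M → (depth R M : WithBot ℕ∞) = ringKrullDim R

/-- `M` has no nonzero free direct summand. -/
def HasNoFreeSummand (R : Type u) [CommRing R]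
    (M : Type v) [AddCommGroup M] [Module R M] : Prop :=
  ∀ N N' : Submodule R M, IsCompl N N' → Module.Free R N → N = ⊥

/-- Auslander's `δ`-invariant of a (finitely generated) module `M` over a local ring `R`: the
smallest `n` for which there is a surjection `X ⊕ Rⁿ → M` with `X` maximal Cohen-Macaulay without
nonzero free direct summand (the value is `⊤` if there is no such `n`). -/
noncomputable def delta (R : Type u) [CommRing R] [IsLocalRing R]
    (M : Type u) [AddCommGroup M] [Module R M] : ℕ∞ :=
  ⨅ (n : ℕ) (_ : ∃ (X : Type u) (_ : AddCommGroup X) (_ : Module R X),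
      IsMaximalCohenMacaulay R X ∧ HasNoFreeSummand R X ∧
        ∃ f : (X × (Fin n → R)) →ₗ[R] M, Function.Surjective f),
    (n : ℕ∞)

/-- `index R = inf {n ≥ 1 | δ_R(R/𝔪ⁿ) = 1}`, which is `⊤` if there is no such `n`. -/
noncomputable def index (R : Type u) [CommRing R] [IsLocalRing R] : ℕ∞ :=
  ⨅ (n : ℕ) (_ : 1 ≤ n ∧ delta R (R ⧸ maximalIdeal R ^ n) = 1), (n : ℕ∞)

/-- `a₁, …, a_d` is a system of parameters of the local ring `R`: `d = dim R` and
`(a₁, …, a_d)` is primary to the maximal ideal. -/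
structure IsSystemOfParameters (R : Type u) [CommRing R] [IsLocalRing R]
    {d : ℕ} (a : Fin d → R) : Prop where
  dim_eq : ringKrullDim R = d
  radical_eq : (Ideal.span (Set.range a)).radical = maximalIdeal R

/-- The generalized Loewy length: the smallest `n ≥ 1` such that `𝔪ⁿ` is contained in the ideal
generated by some system of parameters (`⊤` if there is no such `n`). -/
noncomputable def gll (R : Type u) [CommRing R] [IsLocalRing R] : ℕ∞ :=
  ⨅ (n : ℕ) (_ : 1 ≤ n ∧ ∃ (d : ℕ) (a : Fin d → R), IsSystemOfParameters R a ∧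
      maximalIdeal R ^ n ≤ Ideal.span (Set.range a)),
    (n : ℕ∞)

section SymbolicPowers

variable {R : Type u} [CommRing R] (p : Ideal R) [p.IsPrime]

/-- The symbolic power `p⁽ⁿ⁾ = R ∩ pⁿ R_p`; in particular `p⁽⁰⁾ = R`. -/
noncomputable def symbolicPower (n : ℕ) : Ideal R :=
  ((p ^ n).map (algebraMap R (Localization.AtPrime p))).comap
    (algebraMap R (Localization.AtPrime p))

/-- The `R`-module `p⁽ⁿ⁾ / p⁽ⁿ⁺¹⁾`. -/
abbrev SymbolicGraded (n : ℕ) : Type u :=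
  symbolicPower p n ⧸ (symbolicPower p (n + 1)).submoduleOf (symbolicPower p n)

theorem mul_mem_symbolicPower {m n : ℕ} {x y : R}
    (hx : x ∈ symbolicPower p m) (hy : y ∈ symbolicPower p n) :
    x * y ∈ symbolicPower p (n + m) := by
  simp only [symbolicPower, Ideal.mem_comap, map_mul] at hx hy ⊢
  rw [add_comm, pow_add, Ideal.map_mul]
  exact Ideal.mul_mem_mul hx hy

/-- Multiplication by `x ∈ p⁽ᵗ⁾` as a map `p⁽ⁿ⁾ → p⁽ⁿ⁺ᵗ⁾`. -/
noncomputable def symbolicMul {t : ℕ} {x : R} (hx : x ∈ symbolicPower p t) (n : ℕ) :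
    symbolicPower p n →ₗ[R] symbolicPower p (n + t) :=
  (LinearMap.mulLeft R x).restrict fun _ hy => mul_mem_symbolicPower p hx hy

/-- The map `p⁽ⁿ⁾ / p⁽ⁿ⁺¹⁾ → p⁽ⁿ⁺ᵗ⁾ / p⁽ⁿ⁺ᵗ⁺¹⁾` induced by multiplication by `x ∈ p⁽ᵗ⁾`. -/
noncomputable def symbolicGradedMul {t : ℕ} {x : R} (hx : x ∈ symbolicPower p t) (n : ℕ) :
    SymbolicGraded p n →ₗ[R] SymbolicGraded p (n + t) :=
  Submodule.mapQ _ _ (symbolicMul p hx n) fun y hy => by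
    have h : x * (y : R) ∈ symbolicPower p (n + 1 + t) := mul_mem_symbolicPower p hx hy
    rw [add_right_comm] at h
    exact h

end SymbolicPowers

end CMLocal

namespace CMLocal

open IsLocalRing

section Depth

variable {A : Type u} [CommRing A] [IsLocalRing A] [IsNoetherianRing A]

/-! Let `A` be the localization at `p`, one-dimensional Noetherian with maximal ideal `m`, and put
`J = (x) + m^(s+t-1)`. Injectivity on the graded pieces makes `J` map onto `A/m^s`
(`exists_surjective_quotient_maximalIdeal_pow`). As an ideal, `J` is maximal Cohen-Macaulay, so if
it had no free summand, `δ(A/m^s)` would be 0 rather than 1. Hence `J` has a nonzero free summand,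
which forces `J = (f)` (`exists_eq_span_singleton_of_not_hasNoFreeSummand`). Then `f` is a parameter
with `m^(s+t-1) ⊆ (f)`. -/

theorem depth_le_ringKrullDim {M : Type v} [AddCommGroup M] [Module A M] [Module.Finite A M] :
    (depth A M : WithBot ℕ∞) ≤ ringKrullDim A := by
  obtain ⟨d, hd⟩ := WithBot.ne_bot_iff_exists.mp (ringKrullDim_ne_bot (R := A))
  rw [← hd, WithBot.coe_le_coe]
  refine iSup₂_le fun rs ⟨_, hreg⟩ => ?_
  rw [← WithBot.coe_le_coe, hd]
  have hnt : Nontrivial (M ⧸ Ideal.ofList rs • (⊤ : Submodule A M)) :=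
    Submodule.Quotient.nontrivial_iff.mpr hreg.top_ne_smul.symm
  have h0 : 0 ≤ Module.supportDim A (M ⧸ Ideal.ofList rs • (⊤ : Submodule A M)) :=
    Order.krullDim_nonneg_iff.mpr (Module.nonempty_support_of_nontrivial.to_subtype)
  calc ((rs.length : ℕ∞) : WithBot ℕ∞)
      ≤ Module.supportDim A (M ⧸ Ideal.ofList rs • (⊤ : Submodule A M)) + rs.length := by
        simpa using add_le_add_left h0 ((rs.length : ℕ∞) : WithBot ℕ∞)
    _ = Module.supportDim A M := Module.supportDim_add_length_eq_supportDim_of_isRegular rs hreg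
    _ ≤ ringKrullDim A := Module.supportDim_le_ringKrullDim A M

/-- Over a one-dimensional Noetherian local ring, every ideal is maximal Cohen-Macaulay
as soon as the maximal ideal contains a nonzerodivisor. -/
theorem isMaximalCohenMacaulay_ideal (hdim : ringKrullDim A = 1) {x : A}
    (hx : x ∈ nonZeroDivisors A) (hxm : x ∈ maximalIdeal A) (J : Ideal A) :
    IsMaximalCohenMacaulay A J where
  finite := inferInstance
  depth_eq_dim _ := by
    refine le_antisymm depth_le_ringKrullDim ?_
    have hle : (1 : ℕ∞) ≤ depth A J := by
      refine le_iSup₂_of_le [x] ⟨by simpa using hxm, ?_⟩ (by simp)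
      refine ⟨(RingTheory.Sequence.isWeaklyRegular_singleton_iff J x).mpr ?_, fun h => ?_⟩
      -- A nonzerodivisor of `A` stays regular on any ideal; Nakayama gives `xJ ≠ J`.
      · intro a b hab
        refine Subtype.ext ((mul_cancel_left_mem_nonZeroDivisors hx).mp ?_)
        simpa using congrArg Subtype.val hab
      · refine (top_ne_bot : (⊤ : Submodule A J) ≠ ⊥) ?_
        refine Submodule.eq_bot_of_le_smul_of_le_jacobson_bot (Ideal.ofList [x]) ⊤
          (IsNoetherian.noetherian _) h.le ?_
        rw [jacobson_eq_maximalIdeal ⊥ bot_ne_top]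
        simpa [Ideal.span_le] using hxm
    rw [hdim]
    exact_mod_cast hle

end Depth

/-- An ideal with a nonzero free direct summand is principal. -/
theorem exists_eq_span_singleton_of_not_hasNoFreeSummand {A : Type u} [CommRing A] [Nontrivial A]
    {J : Ideal A} (hJ : ¬ HasNoFreeSummand A J) :
    ∃ f : A, J = Ideal.span {f} := by
  simp only [HasNoFreeSummand, not_forall] at hJ
  obtain ⟨N, N', hc, hfree, hN⟩ := hJ
  let b := Module.Free.chooseBasis A N
  have : Nontrivial N := Submodule.nontrivial_iff_ne_bot.mpr hN
  obtain ⟨i⟩ : Nonempty (Module.Free.ChooseBasisIndex A N) := b.index_nonempty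
  -- This relation between any two elements of an ideal rules out both a nonzero complement of `N`
  -- and a second basis vector.
  have hcomm (c d : J) : (c : A) • d = (d : A) • c := Subtype.ext (mul_comm _ _)
  have hreg (a : A) (h : a • ((b i : N) : J) = 0) : a = 0 := by
    have h' : a • b i = 0 := Subtype.ext h
    have := congrArg (fun v => b.repr v i) h'
    simpa using this
  have hN' : N' = ⊥ := by
    refine (Submodule.eq_bot_iff _).mpr fun n hn => ?_
    have hz : (n : A) • ((b i : N) : J) = 0 := by
      refine (Submodule.disjoint_def.mp hc.disjoint) _ (N.smul_mem _ (b i).2) ?_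
      rw [hcomm]
      exact N'.smul_mem _ hn
    exact Subtype.ext (hreg _ hz)
  have hNtop : N = ⊤ := by simpa [hN'] using hc.sup_eq_top
  have huniq (j) : j = i := by
    by_contra hij
    have h : (((b i : N) : J) : A) • b j = (((b j : N) : J) : A) • b i := Subtype.ext (hcomm _ _)
    have h1 := congrArg (fun v => b.repr v j) h
    have h2 : (((b i : N) : J) : A) = 0 := by
      simpa [Finsupp.single_apply, Ne.symm hij] using h1
    refine one_ne_zero (α := A) (hreg 1 (Subtype.ext ?_))
    simpa using h2
  refine ⟨((b i : N) : J), le_antisymm (fun y hy => ?_) ?_⟩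
  · have hyN : (⟨y, hy⟩ : J) ∈ N := hNtop ▸ Submodule.mem_top
    have : Unique (Module.Free.ChooseBasisIndex A N) := ⟨⟨i⟩, huniq⟩
    have h := b.sum_repr ⟨⟨y, hy⟩, hyN⟩
    rw [Fintype.sum_eq_single i fun j hj => absurd (huniq j) hj] at h
    refine Ideal.mem_span_singleton'.mpr ⟨b.repr ⟨⟨y, hy⟩, hyN⟩ i, ?_⟩
    exact congrArg (fun v : N => ((v : J) : A)) h
  · exact (Ideal.span_singleton_le_iff_mem _).mpr ((b i : N) : J).2

/-- In dimension one, an element of the maximal ideal is a parameter as soon as it generates an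
ideal containing a power of that ideal. -/
theorem gll_le_of_maximalIdeal_pow_le_span_singleton {A : Type u} [CommRing A]
    [IsLocalRing A] (hdim : ringKrullDim A = 1) {f : A}
    (hf : f ∈ maximalIdeal A) {n : ℕ} (hn : 1 ≤ n)
    (h : maximalIdeal A ^ n ≤ Ideal.span {f}) : gll A ≤ n := by
  have hrange : Set.range (fun _ : Fin 1 => f) = {f} := Set.range_const
  refine iInf₂_le n ⟨hn, 1, fun _ => f, ⟨by simpa using hdim, ?_⟩, by rwa [hrange]⟩
  rw [hrange]
  refine le_antisymm ?_ fun y hy => ⟨n, h (Ideal.pow_mem_pow hy n)⟩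
  rw [(maximalIdeal.isMaximal A).isPrime.radical_le_iff]
  exact (Ideal.span_singleton_le_iff_mem _).mpr hf

theorem delta_eq_zero_of_surjective {A : Type u} [CommRing A] [IsLocalRing A]
    {M X : Type u} [AddCommGroup M] [Module A M]
    [AddCommGroup X] [Module A X] (hX : IsMaximalCohenMacaulay A X) (hX' : HasNoFreeSummand A X)
    (φ : X →ₗ[A] M) (hφ : Function.Surjective φ) : delta A M = 0 := by
  refine le_antisymm (iInf₂_le_of_le 0 ⟨X, _, _, hX, hX', φ ∘ₗ LinearMap.fst A X _, ?_⟩ (by simp))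
    zero_le
  exact hφ.comp Prod.fst_surjective

section OneDimensional

variable {A : Type u} [CommRing A] [IsLocalRing A] [IsNoetherianRing A]

/-- If the initial form of `x` is injective in low degrees of the associated graded ring,
then `(x) + 𝔪ᵏ⁺ᵗ` maps onto `A ⧸ 𝔪ᵏ⁺¹`. -/
theorem exists_surjective_quotient_maximalIdeal_pow {x : A} {k t : ℕ}
    (hxt : x ∈ maximalIdeal A ^ t)
    (hx : ∀ a, x * a ∈ maximalIdeal A ^ (k + 1 + t) → a ∈ maximalIdeal A ^ (k + 1)) :
    ∃ φ : (Ideal.span {x} ⊔ maximalIdeal A ^ (k + t) : Ideal A) →ₗ[A]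
      A ⧸ maximalIdeal A ^ (k + 1), Function.Surjective φ := by
  set m := maximalIdeal A with hm
  set J : Ideal A := Ideal.span {x} ⊔ m ^ (k + t)
  -- Modulo `m^(k+1+t)`, `W` is a vector space complement in `m^(k+t)` to the image of `(x) ∩
  -- m^(k+t)`. Thus `J = (x) + W`, and `J/W` is cyclic on the class of `x`.
  obtain ⟨W, ⟨hW1, hW2, hW3⟩, hmax⟩ := set_has_maximal_iff_noetherian.mpr ‹IsNoetherianRing A›
    {W : Ideal A | m ^ (k + 1 + t) ≤ W ∧ W ≤ m ^ (k + t) ∧ W ⊓ Ideal.span {x} ≤ m ^ (k + 1 + t)}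
    ⟨m ^ (k + 1 + t), le_rfl, Ideal.pow_le_pow_right (by omega), inf_le_left⟩
  have hsup : m ^ (k + t) ≤ Ideal.span {x} ⊔ W := by
    intro y hy
    by_contra hyW
    refine hmax (W ⊔ Ideal.span {y}) ⟨hW1.trans le_sup_left,
      sup_le hW2 ((Ideal.span_singleton_le_iff_mem _).mpr hy), ?_⟩ ?_
    · rintro v ⟨hv, hvx⟩
      obtain ⟨w, hw, z, hz, rfl⟩ := Submodule.mem_sup.mp hv
      obtain ⟨a, rfl⟩ := Ideal.mem_span_singleton'.mp hz
      -- A unit `a` would put `y` in `(x) + W`; a nonunit pushes `a * y` into `m^(k+1+t)`, already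
      -- inside `W`.
      by_cases ha : IsUnit a
      · refine absurd ?_ hyW
        rw [← Ideal.unit_mul_mem_iff_mem _ ha, ← add_sub_cancel_left w (a * y)]
        exact sub_mem (Ideal.mem_sup_left hvx) (Ideal.mem_sup_right hw)
      · have hay : a * y ∈ m ^ (k + 1 + t) := by
          rw [add_right_comm, pow_succ']
          exact Ideal.mul_mem_mul ((mem_maximalIdeal a).mpr ha) hy
        exact hW3 ⟨add_mem hw (hW1 hay), hvx⟩
    · refine lt_of_le_of_ne le_sup_left fun h => hyW (Ideal.mem_sup_right ?_)
      rw [h]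
      exact Ideal.mem_sup_right (Ideal.mem_span_singleton_self y)
  have hxJ : x ∈ J := Ideal.mem_sup_left (Ideal.mem_span_singleton_self x)
  let g : A →ₗ[A] J ⧸ W.submoduleOf J :=
    (W.submoduleOf J).mkQ ∘ₗ LinearMap.toSpanSingleton A J ⟨x, hxJ⟩
  have hg : Function.Surjective g := by
    intro q
    obtain ⟨⟨j, hj⟩, rfl⟩ := Submodule.mkQ_surjective _ q
    obtain ⟨z, hz, w, hw, rfl⟩ := Submodule.mem_sup.mp
      (sup_le (le_sup_left (b := W)) hsup hj)
    obtain ⟨a, rfl⟩ := Ideal.mem_span_singleton'.mp hz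
    refine ⟨a, (Submodule.Quotient.eq _).mpr ?_⟩
    simpa [Submodule.submoduleOf] using hw
  have hker : LinearMap.ker g = m ^ (k + 1) := by
    ext a
    have h : a ∈ LinearMap.ker g ↔ a * x ∈ W :=
      Submodule.Quotient.mk_eq_zero (W.submoduleOf J)
    rw [h]
    constructor
    · intro ha
      exact hx a (mul_comm a x ▸ hW3 ⟨ha, Ideal.mem_span_singleton'.mpr ⟨a, rfl⟩⟩)
    · intro ha
      refine hW1 ?_
      rw [pow_add]
      exact Ideal.mul_mem_mul ha hxt
  let e : (J ⧸ W.submoduleOf J) ≃ₗ[A] A ⧸ m ^ (k + 1) :=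
    (LinearMap.quotKerEquivOfSurjective g hg).symm.trans (Submodule.quotEquivOfEq _ _ hker)
  exact ⟨e.toLinearMap ∘ₗ (W.submoduleOf J).mkQ,
    e.surjective.comp (Submodule.mkQ_surjective _)⟩

theorem gll_le_of_delta_eq_one (hdim : ringKrullDim A = 1) {x : A} {k t : ℕ} (ht : 1 ≤ t)
    (hx : x ∈ nonZeroDivisors A) (hxt : x ∈ maximalIdeal A ^ t)
    (hinj : ∀ a, x * a ∈ maximalIdeal A ^ (k + 1 + t) → a ∈ maximalIdeal A ^ (k + 1))
    (hδ : delta A (A ⧸ maximalIdeal A ^ (k + 1)) = 1) : gll A ≤ (k + t : ℕ) := by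
  have hxm : x ∈ maximalIdeal A := Ideal.pow_le_self (by omega) hxt
  obtain ⟨φ, hφ⟩ := exists_surjective_quotient_maximalIdeal_pow hxt hinj
  have hJ := fun h => zero_ne_one (α := ℕ∞) ((delta_eq_zero_of_surjective
    (isMaximalCohenMacaulay_ideal hdim hx hxm _) h φ hφ).symm.trans hδ)
  obtain ⟨f, hf⟩ := exists_eq_span_singleton_of_not_hasNoFreeSummand hJ
  have hJm : Ideal.span {x} ⊔ maximalIdeal A ^ (k + t) ≤ maximalIdeal A :=
    sup_le ((Ideal.span_singleton_le_iff_mem _).mpr hxm) (Ideal.pow_le_self (by omega))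
  refine gll_le_of_maximalIdeal_pow_le_span_singleton hdim (f := f) ?_ (by omega) ?_
  · exact (Ideal.span_singleton_le_iff_mem _).mp (hf ▸ hJm)
  · exact hf ▸ le_sup_right

end OneDimensional

theorem index_eq_coe {A : Type u} [CommRing A] [IsLocalRing A] {s : ℕ} (hs : index A = s) :
    1 ≤ s ∧ delta A (A ⧸ maximalIdeal A ^ s) = 1 := by
  by_contra hcon
  -- If `s` were not attained, `s + 1` would still be a lower bound.
  have h : ((s + 1 : ℕ) : ℕ∞) ≤ index A := by
    refine le_iInf₂ fun n hn => ?_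
    have hsn : (s : ℕ∞) ≤ n := hs ▸ iInf₂_le n hn
    have hne : s ≠ n := fun e => hcon (e ▸ hn)
    have : s ≤ n := by exact_mod_cast hsn
    exact_mod_cast (by omega : s + 1 ≤ n)
  rw [hs] at h
  have : s + 1 ≤ s := by exact_mod_cast h
  omega

section Localization

variable {R : Type u} [CommRing R] (p : Ideal R) [p.IsPrime]

theorem mem_symbolicPower_iff {n : ℕ} {r : R} : r ∈ symbolicPower p n ↔
    algebraMap R (Localization.AtPrime p) r ∈ maximalIdeal (Localization.AtPrime p) ^ n := by
  rw [symbolicPower, Ideal.mem_comap, Ideal.map_pow, Localization.AtPrime.map_eq_maximalIdeal]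

theorem mem_symbolicPower_of_injective {t n : ℕ} {x : R} (hxt : x ∈ symbolicPower p t)
    (hinj : Function.Injective (symbolicGradedMul p hxt n)) {r : R} (hr : r ∈ symbolicPower p n)
    (hxr : x * r ∈ symbolicPower p (n + t + 1)) : r ∈ symbolicPower p (n + 1) := by
  have h : symbolicGradedMul p hxt n (Submodule.Quotient.mk ⟨r, hr⟩) = 0 :=
    (Submodule.Quotient.mk_eq_zero _).mpr hxr
  have h0 := hinj (h.trans (map_zero _).symm)
  rw [Submodule.Quotient.mk_eq_zero] at h0
  exact h0

/-- Denominators are units, so `a` may be replaced by a numerator `r`, which climbs the symbolic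
filtration one degree per injective map. -/
theorem mem_maximalIdeal_pow_of_injective {t s : ℕ} {x : R} (hxt : x ∈ symbolicPower p t)
    (hinj : ∀ n < s, Function.Injective (symbolicGradedMul p hxt n))
    {a : Localization.AtPrime p}
    (ha : algebraMap R _ x * a ∈ maximalIdeal (Localization.AtPrime p) ^ (s + t)) :
    a ∈ maximalIdeal (Localization.AtPrime p) ^ s := by
  obtain ⟨⟨r, u⟩, hru⟩ := IsLocalization.surj p.primeCompl a
  have hu : IsUnit (algebraMap R (Localization.AtPrime p) u) := IsLocalization.map_units _ u
  rw [← Ideal.mul_unit_mem_iff_mem _ hu, mul_assoc, hru, ← map_mul,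
    ← mem_symbolicPower_iff] at ha
  rw [← Ideal.mul_unit_mem_iff_mem _ hu, hru, ← mem_symbolicPower_iff]
  clear hru
  induction s with
  | zero => simp [mem_symbolicPower_iff]
  | succ n ih =>
    rw [add_right_comm] at ha
    refine mem_symbolicPower_of_injective p hxt (hinj n (by omega))
      (ih (fun i hi => hinj i (by omega)) ?_) ha
    rw [mem_symbolicPower_iff] at ha ⊢
    exact Ideal.pow_le_pow_right (by omega) ha

end Localization

end CMLocal

theorem proposition2p22 (R : Type u) [CommRing R] [IsLocalRing R]
    (hR : CMLocal.IsCohenMacaulayLocalRing R)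
    (p : Ideal R) [p.IsPrime] (hp : p.height = 1)
    (s : ℕ) (hs : CMLocal.index (Localization.AtPrime p) = s)
    (t : ℕ) (ht : 1 ≤ t) (x : R) (hx : x ∈ nonZeroDivisors R)
    (hxt : x ∈ CMLocal.symbolicPower p t) (hxt' : x ∉ CMLocal.symbolicPower p (t + 1))
    (hinj : ∀ i : ℕ, 1 ≤ i → i ≤ s →
      Function.Injective (CMLocal.symbolicGradedMul p hxt (i - 1))) :
    CMLocal.gll (Localization.AtPrime p) ≤
      CMLocal.index (Localization.AtPrime p) + (t : ℕ∞) - 1 := by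
  have := hR.isNoetherianRing
  have : IsNoetherianRing (Localization.AtPrime p) :=
    IsLocalization.isNoetherianRing p.primeCompl _ inferInstance
  have hdim : ringKrullDim (Localization.AtPrime p) = 1 := by
    rw [IsLocalization.AtPrime.ringKrullDim_eq_height p, hp]
    rfl
  obtain ⟨hs1, hδ⟩ := CMLocal.index_eq_coe hs
  obtain ⟨k, rfl⟩ := Nat.exists_eq_add_of_le' hs1
  have hgll := CMLocal.gll_le_of_delta_eq_one hdim ht
    (IsLocalization.map_nonZeroDivisors_le p.primeCompl _ (Submonoid.mem_map_of_mem _ hx))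
    ((CMLocal.mem_symbolicPower_iff p).mp hxt)
    (fun a ha => CMLocal.mem_maximalIdeal_pow_of_injective p hxt
      (fun n hn => hinj (n + 1) (by omega) (by omega)) ha) hδ
  rw [hs]
  refine hgll.trans (le_of_eq ?_)
  exact_mod_cast (by omega : k + t = k + 1 + t - 1)
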